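/- Let $n,m\ge 1$ and $0\le k<\min(n,m)$ be integers, and let $D=n^m\setminus\delta_k$ be the diagram obtained from the rectangle with $m$ rows of length $n$ by removing the last $k+1-i$ boxes of row $i$ for $1\le i\le k$. A plane partition of shape $D$ is a filling $T$ of the boxes of $D$ with nonnegative integers that weakly decrease along rows and down columns; its volume is $|T|=\sum_{(i,j)\in D}T[i,j]$, and its rightmost diagonal is $(T[1,n-k],T[2,n-k+1],\dots,T[k+1,n])$. Let $\mu=(\mu_1\ge\mu_2\ge\dots\ge\mu_{k+1}\ge 0)$ be a partition, put $\mu_i=0$ for $i>k+1$ and $|\mu|=\sum_i\mu_i$, and let $0<q<1$. Then $\sum_{T:\,\mathrm{sh}(T)=D}q^{|T|}$ converges, the determinant below is nonzero, and the $q^{\mathrm{vol}}$ distribution of the rightmost diagonal is $$\frac{\displaystyle\sum_{T:\ \mathrm{sh}(T)=D,\ \text{rightmost diagonal }=\mu}q^{|T|}}{\displaystyle\sum_{T:\ \mathrm{sh}(T)=D}q^{|T|}}=\frac{\displaystyle q^{|\mu|(n-k)}\prod_{i=1}^{m}\bigl(1-q^{n-k+i-1}\bigr)\prod_{1\le i<j\le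 m}q^{n-k}\bigl(q^{\mu_j+m-j}-q^{\mu_i+m-i}\bigr)\bigl(1-q^{2n-2k+i+j-2}\bigr)}{\displaystyle\det\Bigl[q^{(n-k+i-1)(m-j)}-(-1)^{k+1}\chi(j>k+1)\,q^{(n-k+i-1)(m-k+j-2)}\Bigr]_{i,j=1}^{m}},$$ where $\chi(j>k+1)$ is $1$ if $j>k+1$ and $0$ otherwise. -/

import Mathlib

/-- The straight diagram of the rectangle `n^m` (`m` rows of length `n`) truncated by the staircase
`δ_k = (k, k-1, …, 1)`: boxes are removed at the right ends of the rows, so that, with rows and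
columns counted from `0`, row `i` consists of its first `n - (k - i)` boxes (truncated subtraction:
`k - i = 0` for `i ≥ k`). -/
def truncatedRectangle (n m k : ℕ) : Finset (ℕ × ℕ) :=
  (Finset.range m ×ˢ Finset.range n).filter fun b => b.2 < n - (k - b.1)

/-- A plane partition of shape `D`: a filling of the boxes of `D` with nonnegative integers that
weakly decrease along rows and down columns. The value outside `D` is `0` by convention. -/
@[ext]
structure PlanePartition (D : Finset (ℕ × ℕ)) where
  entry : ℕ → ℕ → ℕ
  row_weak : ∀ i j₁ j₂, j₁ ≤ j₂ → (i, j₁) ∈ D → (i, j₂) ∈ D → entry i j₂ ≤ entry i j₁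
  col_weak : ∀ i₁ i₂ j, i₁ ≤ i₂ → (i₁, j) ∈ D → (i₂, j) ∈ D → entry i₂ j ≤ entry i₁ j
  zeros : ∀ i j, (i, j) ∉ D → entry i j = 0

/-- The volume of a plane partition: the sum of its entries. -/
def PlanePartition.volume {D : Finset (ℕ × ℕ)} (T : PlanePartition D) : ℕ :=
  ∑ b ∈ D, T.entry b.1 b.2

/-- The rightmost diagonal of a plane partition of shape `n^m ∖ δ_k`, from top to bottom, is
`(μ 0, …, μ k)`. In coordinates counted from `1` it is `(T[1,n-k], T[2,n-k+1], …, T[k+1,n])`. -/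
def PlanePartition.HasRightmostDiagonal {n m k : ℕ}
    (T : PlanePartition (truncatedRectangle n m k)) (μ : ℕ → ℕ) : Prop :=
  ∀ r, r ≤ k → T.entry r (n - k - 1 + r) = μ r

/-- The value at `μ` of the volume distribution of the rightmost diagonal: the proportion of the
plane partitions of shape `n^m ∖ δ_k` with rightmost diagonal `μ`, when each plane partition `T`
has weight `q ^ vol(T)`. -/
noncomputable def diagonalDistribution (n m k : ℕ) (q : ℝ) (μ : ℕ → ℕ) : ℝ :=
  (∑' T : {T : PlanePartition (truncatedRectangle n m k) // T.HasRightmostDiagonal μ},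
      q ^ T.1.volume) /
    ∑' T : PlanePartition (truncatedRectangle n m k), q ^ T.volume

/-- The `m × m` matrix
`[x_i^(m-j) - (-1)^(k+1) χ(j > k+1) x_i^(m-k+j-2)]`, `1 ≤ i, j ≤ m`, at `x_i = q^(n-k+i-1)`;
here the indices are counted from `0`. -/
def kingMatrix (n m k : ℕ) (q : ℝ) : Matrix (Fin m) (Fin m) ℝ :=
  Matrix.of fun i j =>
    q ^ ((n - k + i.1) * (m - 1 - j.1)) -
      (-1) ^ (k + 1) * (if k < j.1 then 1 else 0) * q ^ ((n - k + i.1) * (m - k - 1 + j.1))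

/-!
Extend a plane partition of shape `n^m ∖ δ_k` by zeros to a trapezoid, so that its rightmost
diagonal `μ` runs through all `m` rows. Removing the rightmost diagonal of a plane partition of a
trapezoid leaves one of a smaller trapezoid, whose rightmost diagonal interlaces the removed one.
Since the alternant `det [x_i^(μ_j + m - j)]` summed over an interlacing diagonal is a determinant
of geometric sums, it reproduces an alternant up to a factor independent of `μ`. By induction the
plane partitions with rightmost diagonal `μ` have total weight `C * det [x_i^(μ_j + m - j)]` at
`x_i = q^(n-k+i-1)`, and the constant `C` cancels in the distribution.

The numerator is then a Vandermonde determinant in powers of `q`. The denominator is given by King's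
formula for the sum of the alternants of the partitions with at most `p` parts (here `p = k + 1`),
by induction on the number of variables. If `p` is less than this number, the last column of each
alternant is constant, and expanding along it removes a variable. King's matrix satisfies the same
recursion, because a combination of its columns turns the last one into
`(1 - x_i) ∏_{l ≠ i} (1 - x_l x_i)`. If `p` is equal to the number of variables, subtracting the
last part from all parts reduces to `p - 1` at the cost of a factor `1 / (1 - ∏ x_i)`.
-/

open Finset Matrix

section ColumnOperations

variable {n R : Type*} [Fintype n] [DecidableEq n] [CommRing R]

theorem det_updateCol_eq_zero_of_mem_span (A : Matrix n n R) (j : n) {u : n → R}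
    (hu : u ∈ Submodule.span R (A.col '' {j}ᶜ)) : (A.updateCol j u).det = 0 := by
  induction hu using Submodule.span_induction with
  | mem u hu =>
    obtain ⟨k, hk, rfl⟩ := hu
    exact det_updateCol_eq_zero hk
  | zero => exact det_eq_zero_of_column_eq_zero j (by simp)
  | add u v _ _ hu hv => rw [det_updateCol_add, hu, hv, add_zero]
  | smul c u _ hu => rw [det_updateCol_smul, hu, mul_zero]

theorem det_updateCol_eq_of_sub_mem_span (A : Matrix n n R) (j : n) {v w : n → R}
    (h : v - w ∈ Submodule.span R (A.col '' {j}ᶜ)) :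
    (A.updateCol j v).det = (A.updateCol j w).det := by
  rw [← sub_add_cancel v w, det_updateCol_add, det_updateCol_eq_zero_of_mem_span A j h, zero_add]

end ColumnOperations

section SignedEsymm

variable {ι R : Type*} [Fintype ι] [CommRing R]

/-- The elementary symmetric function of degree `b`, with the sign that makes it the coefficient
of `z ^ b` in `∏ l, (1 - x l * z)`. -/
def signedEsymm (x : ι → R) (b : ℕ) : R :=
  (-1) ^ b * ∑ s ∈ powersetCard b univ, ∏ l ∈ s, x l

theorem signedEsymm_zero (x : ι → R) : signedEsymm x 0 = 1 := by
  simp [signedEsymm]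

theorem signedEsymm_card (x : ι → R) :
    signedEsymm x (Fintype.card ι) = (-1) ^ Fintype.card ι * ∏ l, x l := by
  rw [signedEsymm, ← card_univ, powersetCard_self, sum_singleton]

theorem prod_sub_mul_eq_sum_signedEsymm (x : ι → R) (y z : R) :
    ∏ l, (y - x l * z) =
      ∑ b ∈ range (Fintype.card ι + 1), signedEsymm x b * y ^ (Fintype.card ι - b) * z ^ b := by
  classical
  rw [prod_sub, sum_powerset, card_univ]
  refine sum_congr rfl fun b _ => ?_
  rw [signedEsymm, mul_sum, sum_mul, sum_mul]
  refine sum_congr rfl fun s hs => ?_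
  obtain ⟨hsub, rfl⟩ := mem_powersetCard.1 hs
  rw [prod_const, card_sdiff_of_subset hsub, prod_mul_distrib, prod_const, card_univ]
  ring

theorem sum_signedEsymm_mul_pow_eq_zero (x : ι → R) (i : ι) :
    ∑ b ∈ range (Fintype.card ι + 1), signedEsymm x b * x i ^ (Fintype.card ι - b) = 0 := by
  have hroot : ∏ l, (x i - x l) = 0 := prod_eq_zero (mem_univ i) (sub_self (x i))
  simpa only [mul_one, one_pow, hroot] using (prod_sub_mul_eq_sum_signedEsymm x (x i) 1).symm

end SignedEsymm

section KingMatrix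

variable {R : Type*} [CommRing R] {m : ℕ}

/-- The matrix `[x_i^(m-j) - (-1)^p χ(j > p) x_i^(m-p+j-1)]`, `1 ≤ i, j ≤ m`, of King's formula for
the sum of the Schur functions of partitions with at most `p` parts; here the indices are counted
from `0`. -/
def kingMatrixOf (p : ℕ) (x : Fin m → R) : Matrix (Fin m) (Fin m) R :=
  of fun i j => x i ^ (m - 1 - j.1) - (-1) ^ p * (if p ≤ j.1 then 1 else 0) * x i ^ (m - p + j.1)

/-- The antisymmetrized power `z^b - (-1)^p z^(N-b)`, which up to sign is invariant under
`b ↦ N - b`. The first `m - p` columns of `kingMatrixOf p x`, read from the right, are of this form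
with `N = 2 * m - p - 1`. -/
def kingPow (p N b : ℕ) (z : R) : R := z ^ b - (-1) ^ p * z ^ (N - b)

/-- The coefficients of the power series `(∑ c_b z^b) / (1 + z)`. -/
def quotOneAdd (c : ℕ → R) : ℕ → R
  | 0 => c 0
  | b + 1 => c (b + 1) - quotOneAdd c b

theorem sum_mul_eq_sum_quotOneAdd_mul (c h : ℕ → R) (n : ℕ) :
    ∑ b ∈ range (n + 1), c b * h b =
      ∑ b ∈ range n, quotOneAdd c b * (h b + h (b + 1)) + quotOneAdd c n * h n := by
  induction n with
  | zero => simp [quotOneAdd]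
  | succ n ih => rw [sum_range_succ, ih, sum_range_succ _ n, quotOneAdd]; ring

theorem kingPow_add_kingPow_succ (p : ℕ) {N b : ℕ} (hb : b ≤ N) (z : R) :
    kingPow p (N + 1) b z + kingPow p (N + 1) (b + 1) z = (1 + z) * kingPow p N b z := by
  rw [kingPow, kingPow, kingPow, Nat.add_sub_add_right, Nat.sub_add_comm hb]
  ring

theorem kingPow_two_mul_sub_self {p M : ℕ} (hp : p ≤ M) (z : R) :
    kingPow p (2 * M - p) M z =
      (1 + z) * ∑ t ∈ range p, (-1) ^ (p - 1 - t) * z ^ (M - p + t) := by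
  have hsum : ∑ t ∈ range p, (-1) ^ (p - 1 - t) * z ^ (M - p + t) =
      z ^ (M - p) * ∑ t ∈ range p, z ^ t * (-1) ^ (p - 1 - t) := by
    rw [mul_sum]
    exact sum_congr rfl fun t _ => by ring
  have hpow : z ^ M = z ^ (M - p) * z ^ p := by rw [← pow_add, Nat.sub_add_cancel hp]
  rw [hsum, kingPow, show 2 * M - p - M = M - p by omega, hpow]
  linear_combination -z ^ (M - p) * geom_sum₂_mul z (-1) p

/-- The second terms of the antisymmetrized powers contribute `∏ l, (x i - x l) = 0`. -/
theorem sum_signedEsymm_mul_kingPow {ι : Type*} [Fintype ι] {p : ℕ} (hp : p ≤ Fintype.card ι)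
    (x : ι → R) (i : ι) :
    ∑ b ∈ range (Fintype.card ι + 1),
        signedEsymm x b * kingPow p (2 * Fintype.card ι - p) b (x i) =
      ∏ l, (1 - x l * x i) := by
  set M := Fintype.card ι
  calc ∑ b ∈ range (M + 1), signedEsymm x b * kingPow p (2 * M - p) b (x i)
      = ∑ b ∈ range (M + 1), signedEsymm x b * 1 ^ (M - b) * x i ^ b -
          (-1) ^ p * x i ^ (M - p) * ∑ b ∈ range (M + 1), signedEsymm x b * x i ^ (M - b) := by
        rw [mul_sum, ← sum_sub_distrib]
        refine sum_congr rfl fun b hb => ?_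
        have hexp : 2 * M - p - b = (M - p) + (M - b) := by
          have := mem_range.1 hb
          omega
        rw [kingPow, hexp, pow_add, one_pow]
        ring
    _ = ∏ l, (1 - x l * x i) := by
        rw [sum_signedEsymm_mul_pow_eq_zero, mul_zero, sub_zero, prod_sub_mul_eq_sum_signedEsymm]

theorem one_sub_mul_prod_eq_sum_kingPow {p : ℕ} (hp : p ≤ m) (x : Fin (m + 1) → R)
    {i : Fin (m + 1)} (hx : IsLeftRegular (1 + x i)) :
    (1 - x i) * ∏ l, (1 - x (i.succAbove l) * x i) =
      kingPow p (2 * m + 1 - p) 0 (x i) +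
        ∑ b ∈ range m, quotOneAdd (signedEsymm x) (b + 1) *
          kingPow p (2 * m + 1 - p) (b + 1) (x i) +
        quotOneAdd (signedEsymm x) (m + 1) *
          ∑ t ∈ range p, (-1) ^ (p - 1 - t) * x i ^ (m + 1 - p + t) := by
  set N := 2 * m + 1 - p
  have hN_succ : 2 * (m + 1) - p = N + 1 := by omega
  have htotal := sum_signedEsymm_mul_kingPow (p := p) (by rw [Fintype.card_fin]; omega) x i
  have hpairs : ∑ b ∈ range (m + 1), quotOneAdd (signedEsymm x) b *
      (kingPow p (N + 1) b (x i) + kingPow p (N + 1) (b + 1) (x i)) =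
      (1 + x i) * ∑ b ∈ range (m + 1), quotOneAdd (signedEsymm x) b * kingPow p N b (x i) := by
    rw [mul_sum]
    refine sum_congr rfl fun b hb => ?_
    have := mem_range.1 hb
    rw [kingPow_add_kingPow_succ p (by omega), mul_left_comm]
  have hlast := kingPow_two_mul_sub_self (p := p) (M := m + 1) (by omega) (x i)
  have hzero : quotOneAdd (signedEsymm x) 0 = 1 := signedEsymm_zero x
  rw [hN_succ] at hlast
  rw [Fintype.card_fin, hN_succ,
    sum_mul_eq_sum_quotOneAdd_mul _ fun b => kingPow p (N + 1) b (x i), hpairs,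
    hlast, sum_range_succ', hzero, Fin.prod_univ_succAbove _ i] at htotal
  refine hx ?_
  dsimp only
  linear_combination -htotal

theorem pow_mem_span_col_kingMatrixOf {p b : ℕ} (x : Fin (m + 1) → R) (hpb : m + 1 - p ≤ b)
    (hb : b ≤ m) (hb0 : 0 < b) :
    (fun i => x i ^ b) ∈ Submodule.span R ((kingMatrixOf p x).col '' {Fin.last m}ᶜ) := by
  refine Submodule.subset_span ⟨⟨m - b, by omega⟩, ?_, ?_⟩
  · simp only [Set.mem_compl_iff, Set.mem_singleton_iff, Fin.ext_iff, Fin.val_last]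
    omega
  · funext i
    have hp : ¬ p ≤ m - b := by omega
    simp [kingMatrixOf, hp, Nat.sub_sub_self hb]

theorem kingPow_mem_span_col_kingMatrixOf {p b : ℕ} (hp : p ≤ m) (x : Fin (m + 1) → R)
    (hb0 : 0 < b) (hb : b ≤ m) :
    (fun i => kingPow p (2 * m + 1 - p) b (x i)) ∈
      Submodule.span R ((kingMatrixOf p x).col '' {Fin.last m}ᶜ) := by
  rcases lt_or_ge b (m + 1 - p) with hlt | hge
  · refine Submodule.subset_span ⟨⟨m - b, by omega⟩, ?_, ?_⟩
    · simp only [Set.mem_compl_iff, Set.mem_singleton_iff, Fin.ext_iff, Fin.val_last]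
      omega
    · funext i
      have hpb : p ≤ m - b := by omega
      have hexp : m + 1 - p + (m - b) = 2 * m + 1 - p - b := by omega
      simp [kingMatrixOf, kingPow, hpb, hexp, Nat.sub_sub_self hb]
  · exact Submodule.sub_mem _ (pow_mem_span_col_kingMatrixOf x hge hb hb0)
      (Submodule.smul_mem _ ((-1) ^ p)
        (pow_mem_span_col_kingMatrixOf x (by omega) (by omega) (by omega)))

theorem prod_sub_col_last_mem_span_col_kingMatrixOf {p : ℕ} (hp : p ≤ m) (x : Fin (m + 1) → R)
    (hx : ∀ i, IsLeftRegular (1 + x i)) :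
    (fun i => (1 - x i) * ∏ l, (1 - x (i.succAbove l) * x i)) -
        (kingMatrixOf p x).col (Fin.last m) ∈
      Submodule.span R ((kingMatrixOf p x).col '' {Fin.last m}ᶜ) := by
  have hdiff : (fun i => (1 - x i) * ∏ l, (1 - x (i.succAbove l) * x i)) -
      (kingMatrixOf p x).col (Fin.last m) =
        ∑ b ∈ range m, quotOneAdd (signedEsymm x) (b + 1) •
          (fun i => kingPow p (2 * m + 1 - p) (b + 1) (x i)) +
        quotOneAdd (signedEsymm x) (m + 1) •
          ∑ t ∈ range p, (-1 : R) ^ (p - 1 - t) • fun i => x i ^ (m + 1 - p + t) := by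
    funext i
    have hcol : kingMatrixOf p x i (Fin.last m) = kingPow p (2 * m + 1 - p) 0 (x i) := by
      have hexp : m + 1 - p + m = 2 * m + 1 - p := by omega
      simp [kingMatrixOf, kingPow, hp, hexp]
    simp only [Pi.sub_apply, Pi.add_apply, Pi.smul_apply, Finset.sum_apply, smul_eq_mul, col_apply,
      one_sub_mul_prod_eq_sum_kingPow hp x (hx i), hcol]
    ring
  rw [hdiff]
  refine Submodule.add_mem _ (Submodule.sum_mem _ fun b hb => Submodule.smul_mem _ _ ?_)
    (Submodule.smul_mem _ _ (Submodule.sum_mem _ fun t ht => Submodule.smul_mem _ _ ?_))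
  · exact kingPow_mem_span_col_kingMatrixOf hp x b.succ_pos (mem_range.1 hb)
  · have := mem_range.1 ht
    exact pow_mem_span_col_kingMatrixOf x (by omega) (by omega) (by omega)

theorem det_kingMatrixOf_succ {p : ℕ} (hp : p ≤ m) (x : Fin (m + 1) → R)
    (hx : ∀ i, IsLeftRegular (1 + x i)) :
    (kingMatrixOf p x).det = ∑ t : Fin (m + 1), (-1) ^ (t.1 + m) *
      ((1 - x t) * ∏ l, (1 - x (t.succAbove l) * x t)) *
      ((∏ l, x (t.succAbove l)) * (kingMatrixOf p (x ∘ t.succAbove)).det) := by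
  have hcol := det_updateCol_eq_of_sub_mem_span _ _
    (prod_sub_col_last_mem_span_col_kingMatrixOf hp x hx)
  rw [show (kingMatrixOf p x).updateCol _ ((kingMatrixOf p x).col _) = _ from
    updateCol_eq_self _ _] at hcol
  rw [← hcol, det_succ_column _ (Fin.last m)]
  refine sum_congr rfl fun t _ => ?_
  rw [updateCol_self, Fin.val_last, ← det_mul_column]
  congr 2
  ext i j
  have hj := j.2
  rw [submatrix_apply, updateCol_ne (Fin.succAbove_ne _ _)]
  simp only [kingMatrixOf, of_apply, Fin.succAbove_last, Fin.val_castSucc, Function.comp_apply,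
    show m + 1 - 1 - j.1 = (m - 1 - j.1) + 1 by omega,
    show m + 1 - p + j.1 = (m - p + j.1) + 1 by omega]
  ring

/-- Modulo its other columns, `z ^ (m + 1)` is proportional to the last column of the Vandermonde
matrix, because each `x i` is a root of `∏ l, (z - x l)`. -/
theorem det_kingMatrixOf_eq_one_sub_prod_mul (x : Fin (m + 1) → R) :
    (kingMatrixOf m x).det = (1 - ∏ l, x l) * (kingMatrixOf (m + 1) x).det := by
  set A := kingMatrixOf (m + 1) x with hA
  have hA_apply (i j) : A i j = x i ^ (m - j.1) := by
    simp [hA, kingMatrixOf, Nat.le_of_lt_succ j.2]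
  have hupdate : kingMatrixOf m x =
      A.updateCol (Fin.last m) fun i => 1 - (-1) ^ m * x i ^ (m + 1) := by
    ext i j
    induction j using Fin.lastCases with
    | last => simp [kingMatrixOf, add_comm]
    | cast j =>
      rw [updateCol_ne (Fin.castSucc_lt_last j).ne, hA_apply]
      simp [kingMatrixOf, j.2]
  have hcombination : ((fun i => 1 - (-1) ^ m * x i ^ (m + 1)) -
      (1 - ∏ l, x l) • A.col (Fin.last m)) =
        ∑ j : Fin m, ((-1) ^ m * signedEsymm x (j.1 + 1)) • A.col j.castSucc := by
    funext i
    have hroot := sum_signedEsymm_mul_pow_eq_zero x i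
    have hconst := signedEsymm_card x
    have hsign : (-1 : R) ^ m * (-1) ^ m = 1 := by rw [← mul_pow]; simp
    simp only [Fintype.card_fin, sum_range_succ' _ (m + 1), sum_range_succ _ m, sum_range,
      signedEsymm_zero] at hroot hconst
    simp only [Pi.sub_apply, Finset.sum_apply, Pi.smul_apply, smul_eq_mul, col_apply, hA_apply,
      Fin.val_last, Fin.val_castSucc, mul_assoc, ← mul_sum]
    simp only [Nat.add_sub_add_right, Nat.sub_self, Nat.sub_zero, pow_zero] at hroot ⊢
    rw [hconst, pow_succ (-1 : R)] at hroot
    linear_combination -(-1 : R) ^ m * hroot - (∏ l, x l) * hsign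
  rw [hupdate, det_updateCol_eq_of_sub_mem_span (w := (1 - ∏ l, x l) • A.col (Fin.last m)),
    det_updateCol_smul, show A.updateCol _ (A.col _) = A from updateCol_eq_self A _]
  · rw [hcombination]
    exact Submodule.sum_mem _ fun j _ => Submodule.smul_mem _ _
      (Submodule.subset_span ⟨j.castSucc, (Fin.castSucc_lt_last j).ne, rfl⟩)

end KingMatrix

section Alternant

variable {R : Type*} [CommRing R] {m : ℕ}

/-- The alternant `det [x_i^(ν_j + m - j)]`, `1 ≤ i, j ≤ m`, which is the Schur function of `ν`
times the Vandermonde determinant; here the indices are counted from `0`. -/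
def alternant (x : Fin m → R) (ν : Fin m → ℕ) : R :=
  (of fun i j => x i ^ (ν j + (m - 1 - j.1))).det

theorem alternant_const_mul (c : R) (x : Fin m → R) (ν : Fin m → ℕ) :
    alternant (fun i => c * x i) ν =
      c ^ (∑ j, ν j) * c ^ (∑ j : Fin m, (m - 1 - j.1)) * alternant x ν := by
  rw [alternant, alternant, ← pow_add, ← sum_add_distrib, ← prod_pow_eq_pow_sum, ← det_mul_row]
  simp only [mul_pow, of_apply]

theorem alternant_add_const (x : Fin m → R) (ν : Fin m → ℕ) (t : ℕ) :
    alternant x (fun j => ν j + t) = (∏ i, x i) ^ t * alternant x ν := by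
  rw [alternant, alternant, ← prod_pow, ← det_mul_column]
  simp only [of_apply, ← pow_add, add_right_comm, add_comm t]

theorem alternant_succ_of_last_eq_zero (x : Fin (m + 1) → R) {ν : Fin (m + 1) → ℕ}
    (hν : ν (Fin.last m) = 0) :
    alternant x ν = ∑ t : Fin (m + 1), (-1) ^ (t.1 + m) *
      ((∏ l, x (t.succAbove l)) * alternant (x ∘ t.succAbove) (ν ∘ Fin.castSucc)) := by
  rw [alternant, det_succ_column _ (Fin.last m)]
  refine sum_congr rfl fun t _ => ?_
  have hlast : x t ^ (ν (Fin.last m) + (m + 1 - 1 - (Fin.last m).1)) = 1 := by simp [hν]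
  rw [of_apply, hlast, mul_one, alternant, ← det_mul_column, Fin.val_last]
  congr 2
  ext i j
  have hexp : m + 1 - 1 - j.1 = (m - 1 - j.1) + 1 := by omega
  simp only [submatrix_apply, of_apply, Fin.succAbove_last, Fin.val_castSucc, Function.comp_apply,
    hexp]
  ring

theorem alternant_pow (q : R) (N : ℕ) (ν : Fin m → ℕ) :
    alternant (fun i => q ^ (N + i.1)) ν = (∏ j : Fin m, q ^ (N * (ν j + (m - 1 - j.1)))) *
      ∏ j : Fin m, ∏ i ∈ Iio j, (q ^ (ν j + (m - 1 - j.1)) - q ^ (ν i + (m - 1 - i.1))) := by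
  have hcomm := prod_comm' (s := univ) (t := fun i => Ioi i) (t' := univ) (s' := fun j => Iio j)
    (f := fun i j : Fin m => q ^ (ν j + (m - 1 - j.1)) - q ^ (ν i + (m - 1 - i.1))) (by simp)
  rw [← hcomm, ← det_vandermonde, ← det_mul_column, alternant, ← det_transpose]
  congr 1
  ext j i
  simp only [transpose_apply, of_apply, vandermonde_apply]
  ring

/-- The matrix obtained from that of the alternant by subtracting from each column its left
neighbour. -/
def alternantDiffMatrix (x : Fin (m + 1) → R) (ν : Fin (m + 1) → ℕ) :
    Matrix (Fin (m + 1)) (Fin (m + 1)) R :=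
  of fun i => Fin.cons (x i ^ (ν 0 + m)) fun j =>
    x i ^ (ν j.succ + (m - 1 - j.1)) - x i ^ (ν j.castSucc + (m - 1 - j.1 + 1))

theorem det_alternantDiffMatrix (x : Fin (m + 1) → R) (ν : Fin (m + 1) → ℕ) :
    (alternantDiffMatrix x ν).det = alternant x ν := by
  refine (det_eq_of_forall_col_eq_smul_add_pred (fun _ => 1)
    (fun i => by simp [alternantDiffMatrix]) fun i j => ?_).symm
  have hsucc : m + 1 - 1 - (j.1 + 1) = m - 1 - j.1 := by omega
  have hcast : m + 1 - 1 - j.1 = m - 1 - j.1 + 1 := by omega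
  simp only [alternantDiffMatrix, of_apply, Fin.cons_succ, Fin.val_succ, Fin.val_castSucc, hsucc,
    hcast]
  ring

theorem alternant_cons_one (x : Fin m → R) (ν : Fin (m + 1) → ℕ) :
    alternant (Fin.cons 1 x) ν = (of fun i j : Fin m =>
      x i ^ (ν j.succ + (m - 1 - j.1)) - x i ^ (ν j.castSucc + (m - 1 - j.1 + 1))).det := by
  rw [← det_alternantDiffMatrix, det_succ_row_zero, Fin.sum_univ_succ, Fintype.sum_eq_zero]
  · simp only [alternantDiffMatrix, of_apply, Fin.cons_zero, one_pow, Fin.val_zero, pow_zero,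
      one_mul, Fin.succAbove_zero, add_zero]
    rfl
  · simp [alternantDiffMatrix]

end Alternant

section LittlewoodProduct

theorem prod_prod_Iio_eq_mul_succAbove {M : Type*} [CommMonoid M] {m : ℕ}
    (f : Fin (m + 1) → Fin (m + 1) → M) (hf : ∀ i j, f i j = f j i) (t : Fin (m + 1)) :
    ∏ j, ∏ i ∈ Iio j, f i j = (∏ l, f (t.succAbove l) t) *
      ∏ j, ∏ i ∈ Iio j, f (t.succAbove i) (t.succAbove j) := by
  have hite {r : ℕ} (j : Fin r) (g : Fin r → M) :
      ∏ i ∈ Iio j, g i = ∏ i, if i < j then g i else 1 := by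
    rw [← prod_filter, filter_gt_eq_Iio]
  simp only [hite, Fin.prod_univ_succAbove _ t, lt_irrefl, if_false, one_mul, prod_mul_distrib,
    Fin.succAbove_lt_succAbove_iff]
  rw [← mul_assoc, ← prod_mul_distrib]
  congr 1
  refine prod_congr rfl fun l _ => ?_
  rcases (Fin.succAbove_ne t l).lt_or_gt with hlt | hgt
  · rw [if_pos hlt, if_neg hlt.not_gt, mul_one]
  · rw [if_neg hgt.not_gt, if_pos hgt, one_mul, hf]

/-- The product `∏ (1 - x_i) ∏_{i < j} (1 - x_i x_j)`, by Littlewood's identity the inverse of the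
sum of all Schur functions of `x`. -/
def littlewoodProd {R : Type*} [CommRing R] {m : ℕ} (x : Fin m → R) : R :=
  (∏ i, (1 - x i)) * ∏ j, ∏ i ∈ Iio j, (1 - x i * x j)

theorem littlewoodProd_succAbove {R : Type*} [CommRing R] {m : ℕ} (x : Fin (m + 1) → R)
    (t : Fin (m + 1)) :
    littlewoodProd x = ((1 - x t) * ∏ l, (1 - x (t.succAbove l) * x t)) *
      littlewoodProd (x ∘ t.succAbove) := by
  rw [littlewoodProd, littlewoodProd, Fin.prod_univ_succAbove _ t,
    prod_prod_Iio_eq_mul_succAbove _ (fun i j => by rw [mul_comm (x i)]) t]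
  simp only [Function.comp_apply]
  ring

theorem littlewoodProd_ne_zero {𝕜 : Type*} [NormedField 𝕜] {m : ℕ} {x : Fin m → 𝕜}
    (hx : ∀ i, ‖x i‖ < 1) : littlewoodProd x ≠ 0 := by
  have hne {y : 𝕜} (hy : ‖y‖ < 1) : 1 - y ≠ 0 := fun h => by
    rw [← sub_eq_zero.1 h, norm_one] at hy
    exact hy.false
  refine mul_ne_zero (prod_ne_zero_iff.2 fun i _ => hne (hx i))
    (prod_ne_zero_iff.2 fun j _ => prod_ne_zero_iff.2 fun i _ => hne ?_)
  rw [norm_mul]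
  exact mul_lt_one_of_nonneg_of_lt_one_left (norm_nonneg _) (hx i) (hx j).le

end LittlewoodProduct

section KingIdentity

/-- Partitions with at most `p` parts, as weakly decreasing sequences indexed from `0`. -/
abbrev BoundedPartition (p : ℕ) : Type := {μ : ℕ → ℕ // Antitone μ ∧ ∀ i, p ≤ i → μ i = 0}

/-- A partition with at most `m + 1` parts is determined by its last part and by the partition with
at most `m` parts obtained by subtracting the last part from all the parts. -/
def boundedPartitionSuccEquiv (m : ℕ) : BoundedPartition m × ℕ ≃ BoundedPartition (m + 1) where
  toFun a := ⟨fun i => if i ≤ m then a.1.1 i + a.2 else 0, fun i j hij => by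
    have := a.1.2.1 hij
    dsimp only
    split_ifs <;> omega, fun i hi => if_neg (by omega)⟩
  invFun ν := (⟨fun i => ν.1 i - ν.1 m, fun _ _ hij => Nat.sub_le_sub_right (ν.2.1 hij) _,
    fun _ hi => Nat.sub_eq_zero_of_le (ν.2.1 hi)⟩, ν.1 m)
  left_inv a := by
    have hm := a.1.2.2 m le_rfl
    refine Prod.ext (Subtype.ext (funext fun i => ?_)) (by simp [hm])
    have hzero : m ≤ i → a.1.1 i = 0 := a.1.2.2 i
    simp only [le_refl, if_true, hm]
    split_ifs <;> omega
  right_inv ν := by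
    refine Subtype.ext (funext fun i => ?_)
    have hle : i ≤ m → ν.1 m ≤ ν.1 i := fun hi => ν.2.1 hi
    have hzero : m + 1 ≤ i → ν.1 i = 0 := ν.2.2 i
    dsimp only
    split_ifs <;> omega

variable {𝕜 : Type*} [RCLike 𝕜]

theorem hasSum_mul_of_hasSum {α β : Type*} {f : α → 𝕜} {g : β → 𝕜} {s t : 𝕜}
    (hf : HasSum f s) (hg : HasSum g t) : HasSum (fun a : α × β => f a.1 * g a.2) (s * t) :=
  hf.mul hg (summable_mul_of_summable_norm hf.summable.norm hg.summable.norm)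

theorem hasSum_alternant_succ {m p : ℕ} (hp : p ≤ m) {x : Fin (m + 1) → 𝕜}
    (hx : ∀ i, ‖x i‖ < 1)
    (ih : ∀ t : Fin (m + 1), HasSum
      (fun μ : BoundedPartition p => alternant (x ∘ t.succAbove) fun j => μ.1 j)
      ((kingMatrixOf p (x ∘ t.succAbove)).det / littlewoodProd (x ∘ t.succAbove))) :
    HasSum (fun μ : BoundedPartition p => alternant x fun j => μ.1 j)
      ((kingMatrixOf p x).det / littlewoodProd x) := by
  have hreg (i) : IsLeftRegular (1 + x i) := by
    refine IsLeftCancelMulZero.mul_left_cancel_of_ne_zero fun h => ?_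
    have := hx i
    rw [← neg_eq_of_add_eq_zero_right h, norm_neg, norm_one] at this
    exact this.false
  have hexpand (μ : BoundedPartition p) :=
    alternant_succ_of_last_eq_zero x (ν := fun j => μ.1 j) (μ.2.2 m hp)
  have hsum : (kingMatrixOf p x).det / littlewoodProd x = ∑ t : Fin (m + 1), (-1) ^ (t.1 + m) *
      ((∏ l, x (t.succAbove l)) *
        ((kingMatrixOf p (x ∘ t.succAbove)).det / littlewoodProd (x ∘ t.succAbove))) := by
    rw [det_kingMatrixOf_succ hp x hreg, sum_div]
    refine sum_congr rfl fun t _ => ?_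
    have hne := littlewoodProd_ne_zero hx
    rw [littlewoodProd_succAbove x t] at hne ⊢
    rw [mul_right_comm, mul_comm, mul_div_mul_left _ _ (left_ne_zero_of_mul hne), mul_div_assoc,
      mul_div_assoc]
  simp only [hexpand, hsum]
  exact hasSum_sum fun t _ => ((ih t).mul_left _).mul_left _

theorem hasSum_alternant_of_hasSum_pred {m : ℕ} {x : Fin (m + 1) → 𝕜} (hx : ∀ i, ‖x i‖ < 1)
    (h : HasSum (fun μ : BoundedPartition m => alternant x fun j => μ.1 j)
      ((kingMatrixOf m x).det / littlewoodProd x)) :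
    HasSum (fun μ : BoundedPartition (m + 1) => alternant x fun j => μ.1 j)
      ((kingMatrixOf (m + 1) x).det / littlewoodProd x) := by
  have hprod : ‖∏ l, x l‖ < 1 := by
    rw [norm_prod, Fin.prod_univ_succ]
    exact mul_lt_one_of_nonneg_of_lt_one_left (norm_nonneg _) (hx 0)
      (prod_le_one (fun _ _ => norm_nonneg _) fun _ _ => (hx _).le)
  have hne : 1 - ∏ l, x l ≠ 0 := fun h => by
    rw [← sub_eq_zero.1 h, norm_one] at hprod
    exact hprod.false
  rw [← (boundedPartitionSuccEquiv m).hasSum_iff]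
  convert hasSum_mul_of_hasSum h (hasSum_geometric_of_norm_lt_one hprod) using 1
  · funext a
    rw [mul_comm, ← alternant_add_const]
    exact congrArg _ (funext fun j => if_pos (Nat.lt_succ_iff.1 j.2))
  · rw [det_kingMatrixOf_eq_one_sub_prod_mul]
    field_simp

/-- This is King's identity for Schur functions, multiplied by the Vandermonde determinant. -/
theorem hasSum_alternant_boundedPartition {m p : ℕ} (hp : p ≤ m) {x : Fin m → 𝕜}
    (hx : ∀ i, ‖x i‖ < 1) :
    HasSum (fun μ : BoundedPartition p => alternant x fun j => μ.1 j)
      ((kingMatrixOf p x).det / littlewoodProd x) := by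
  induction m generalizing p with
  | zero =>
    obtain rfl := Nat.le_zero.1 hp
    have : Unique (BoundedPartition 0) :=
      { default := ⟨fun _ => 0, fun _ _ _ => le_rfl, fun _ _ => rfl⟩
        uniq := fun a => Subtype.ext (funext fun i => a.2.2 i i.zero_le) }
    simp [alternant, littlewoodProd]
  | succ m ih =>
    have hsucc {p : ℕ} (hp : p ≤ m) := hasSum_alternant_succ hp hx fun t => ih hp fun i => hx _
    rcases hp.lt_or_eq with hlt | rfl
    · exact hsucc (Nat.le_of_lt_succ hlt)
    · exact hasSum_alternant_of_hasSum_pred hx (hsucc le_rfl)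

end KingIdentity

section InterlacingSums

variable {𝕜 : Type*} [RCLike 𝕜] {m : ℕ}

theorem hasSum_pi_prod {α : Fin m → Type*} {g : ∀ j, α j → 𝕜} {s : Fin m → 𝕜}
    (hg : ∀ j, HasSum (g j) (s j)) :
    HasSum (fun f : ∀ j, α j => ∏ j, g j (f j)) (∏ j, s j) := by
  induction m with
  | zero => simp
  | succ m ih =>
    rw [← (Fin.consEquiv α).hasSum_iff, Fin.prod_univ_succ]
    convert hasSum_mul_of_hasSum (hg 0) (ih fun j => hg j.succ) using 1
    funext a
    simp [Fin.consEquiv, Fin.prod_univ_succ]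

theorem hasSum_det {α : Fin m → Type*} {g : Fin m → ∀ j, α j → 𝕜} {A : Matrix (Fin m) (Fin m) 𝕜}
    (hg : ∀ i j, HasSum (g i j) (A i j)) :
    HasSum (fun f : ∀ j, α j => (of fun i j => g i j (f j)).det) A.det := by
  simp only [det_apply, of_apply]
  exact hasSum_sum fun σ _ => (hasSum_pi_prod fun j => hg (σ j) j).const_smul _

theorem hasSum_alternant_forall_mem {x c : Fin m → 𝕜} {S : Fin m → Set ℕ}
    {A : Matrix (Fin m) (Fin m) 𝕜}
    (h : ∀ i j, HasSum (fun l : S j => x i ^ (l.1 + (m - 1 - j.1))) (c i * A i j)) :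
    HasSum (fun ν : {ν : Fin m → ℕ // ∀ j, ν j ∈ S j} => alternant x ν.1)
      ((∏ i, c i) * A.det) := by
  rw [← det_mul_column, ← Equiv.subtypePiEquivPi.symm.hasSum_iff]
  exact hasSum_det (g := fun i j (l : S j) => x i ^ (l.1 + (m - 1 - j.1))) h

theorem hasSum_pow_add_Ici {x : 𝕜} (hx : ‖x‖ < 1) (a d : ℕ) :
    HasSum (fun l : Set.Ici a => x ^ (l.1 + d)) ((1 - x)⁻¹ * x ^ (a + d)) := by
  have hrange : Set.range (a + ·) = Set.Ici a := by
    ext l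
    simp [le_iff_exists_add, eq_comm]
  have hshift : (fun l => x ^ (l + d)) ∘ (a + ·) = fun l => x ^ l * x ^ (a + d) := by
    funext l
    rw [Function.comp_apply]
    ring
  rw [← hrange, (add_right_injective a).hasSum_range_iff (f := fun l => x ^ (l + d)), hshift]
  exact (hasSum_geometric_of_norm_lt_one hx).mul_right _

theorem hasSum_pow_add_Icc {x : 𝕜} (hx : x ≠ 1) {a b : ℕ} (hab : a ≤ b) (d : ℕ) :
    HasSum (fun l : Set.Icc a b => x ^ (l.1 + d))
      ((1 - x)⁻¹ * (x ^ (a + d) - x ^ (b + (d + 1)))) := by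
  have hsum : ∑ l ∈ Finset.Icc a b, x ^ (l + d) =
      (1 - x)⁻¹ * (x ^ (a + d) - x ^ (b + (d + 1))) := by
    simp only [pow_add _ _ d]
    rw [← sum_mul, ← Finset.Ico_succ_right_eq_Icc, geom_sum_Ico' hx (by simp; omega)]
    simp
    ring
  rw [← Finset.coe_Icc, ← hsum]
  exact Finset.hasSum _ _

/-- `ν'` interlaces `ν` from below: `ν_1 ≥ ν'_1 ≥ ν_2 ≥ … ≥ ν'_m ≥ ν_{m+1}`. -/
def InterlacesBelow (ν' : Fin m → ℕ) (ν : Fin (m + 1) → ℕ) : Prop :=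
  ∀ j, ν' j ∈ Set.Icc (ν j.succ) (ν j.castSucc)

/-- `ν'` interlaces `ν` from above: `ν'_1 ≥ ν_1 ≥ ν'_2 ≥ ν_2 ≥ … ≥ ν'_{m+1} ≥ ν_{m+1}`. -/
def InterlacesAbove (ν' ν : Fin (m + 1) → ℕ) : Prop :=
  ν 0 ≤ ν' 0 ∧ InterlacesBelow (Fin.tail ν') ν

theorem InterlacesBelow.antitone {ν' : Fin m → ℕ} {ν : Fin (m + 1) → ℕ}
    (h : InterlacesBelow ν' ν) : Antitone ν' := by
  obtain _ | m := m
  · exact fun i => i.elim0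
  · exact Fin.antitone_iff_succ_le.2 fun i => (h i.succ).2.trans (h i.castSucc).1

theorem InterlacesAbove.antitone {ν' ν : Fin (m + 1) → ℕ} (h : InterlacesAbove ν' ν) :
    Antitone ν' := by
  have hle (j : Fin (m + 1)) : ν j ≤ ν' j := Fin.cases h.1 (fun j => (h.2 j).1) j
  exact Fin.antitone_iff_succ_le.2 fun j => (h.2 j).2.trans (hle j.castSucc)

theorem hasSum_alternant_interlacesBelow {x : Fin m → 𝕜} (hx : ∀ i, x i ≠ 1)
    {ν : Fin (m + 1) → ℕ} (hν : Antitone ν) :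
    HasSum (fun ν' : {ν' : Fin m → ℕ // InterlacesBelow ν' ν} => alternant x ν'.1)
      ((∏ i, (1 - x i)⁻¹) * alternant (Fin.cons 1 x) ν) := by
  rw [alternant_cons_one]
  exact hasSum_alternant_forall_mem fun i j =>
    hasSum_pow_add_Icc (hx i) (hν Fin.castSucc_lt_succ.le) _

theorem hasSum_alternant_interlacesAbove {x : Fin (m + 1) → 𝕜} (hx : ∀ i, ‖x i‖ < 1)
    {ν : Fin (m + 1) → ℕ} (hν : Antitone ν) :
    HasSum (fun ν' : {ν' : Fin (m + 1) → ℕ // InterlacesAbove ν' ν} => alternant x ν'.1)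
      ((∏ i, (1 - x i)⁻¹) * alternant x ν) := by
  let S : Fin (m + 1) → Set ℕ :=
    Fin.cons (Set.Ici (ν 0)) fun j => Set.Icc (ν j.succ) (ν j.castSucc)
  have hS (ν' : Fin (m + 1) → ℕ) : InterlacesAbove ν' ν ↔ ∀ j, ν' j ∈ S j :=
    (Fin.forall_fin_succ (P := fun j => ν' j ∈ S j)).symm
  rw [← (Equiv.subtypeEquivRight fun ν' => (hS ν').symm).hasSum_iff, ← det_alternantDiffMatrix]
  refine hasSum_alternant_forall_mem fun i j => ?_
  induction j using Fin.cases with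
  | zero => exact hasSum_pow_add_Ici (hx i) (ν 0) m
  | succ j =>
    have hexp : m + 1 - 1 - j.succ.1 = m - 1 - j.1 := by rw [Fin.val_succ]; omega
    have hne : x i ≠ 1 := fun h => (hx i).ne (h ▸ norm_one)
    rw [hexp]
    exact hasSum_pow_add_Icc hne (hν Fin.castSucc_lt_succ.le) _

end InterlacingSums

section Diagonals

instance {D : Finset (ℕ × ℕ)} : Zero (PlanePartition D) where
  zero := ⟨0, fun _ _ _ _ _ _ => le_rfl, fun _ _ _ _ _ _ => le_rfl, fun _ _ _ => rfl⟩

/-- The restriction of a plane partition of shape `D` to a smaller shape `E`. -/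
def PlanePartition.restrict {D E : Finset (ℕ × ℕ)} (hED : E ⊆ D) (T : PlanePartition D) :
    PlanePartition E where
  entry i j := if (i, j) ∈ E then T.entry i j else 0
  row_weak i j₁ j₂ hj h₁ h₂ := by
    rw [if_pos h₁, if_pos h₂]
    exact T.row_weak i j₁ j₂ hj (hED h₁) (hED h₂)
  col_weak i₁ i₂ j hi h₁ h₂ := by
    rw [if_pos h₁, if_pos h₂]
    exact T.col_weak i₁ i₂ j hi (hED h₁) (hED h₂)
  zeros _ _ h := if_neg h

/-- The diagram with `m` rows, row `i` (counted from `0`) consisting of its first `i + N` boxes.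
Plane partitions of this shape are built up from their diagonals. -/
def trapezoid (N m : ℕ) : Finset (ℕ × ℕ) :=
  (range m ×ˢ range (m + N)).filter fun b => b.2 < b.1 + N

theorem mem_trapezoid {N m i j : ℕ} : (i, j) ∈ trapezoid N m ↔ i < m ∧ j < i + N := by
  simp only [trapezoid, mem_filter, mem_product, mem_range]
  omega

theorem trapezoid_subset_trapezoid_succ (N m : ℕ) : trapezoid N m ⊆ trapezoid (N + 1) m := by
  rintro ⟨i, j⟩ h
  rw [mem_trapezoid] at h ⊢
  omega

theorem volume_trapezoid {N m : ℕ} (T : PlanePartition (trapezoid N m)) :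
    T.volume = ∑ i ∈ range m, ∑ j ∈ range (i + N), T.entry i j := by
  refine sum_finset_product (f := fun b : ℕ × ℕ => T.entry b.1 b.2) _ _ _ fun b => ?_
  rw [← Prod.mk.eta (p := b), mem_trapezoid]
  simp only [mem_range]

/-- The rightmost diagonal of a plane partition of trapezoidal shape. -/
def trapezoidDiagonal {N m : ℕ} (T : PlanePartition (trapezoid (N + 1) m)) : Fin m → ℕ :=
  fun r => T.entry r (r + N)

/-- The condition for `ν` to be placed as a new diagonal along the right end of `T`: it compares
`ν r` with its left neighbour and with its neighbour below, when these exist. -/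
def Appendable {N m : ℕ} (T : PlanePartition (trapezoid N m)) (ν : Fin m → ℕ) : Prop :=
  ∀ r : Fin m, (∀ j, j + 1 = r.1 + N → ν r ≤ T.entry r j) ∧
    (r.1 + 1 < m → T.entry (r + 1) (r + N) ≤ ν r)

/-- The plane partition obtained from `T` by appending the diagonal `ν` on the right. -/
def appendDiagonal {N m : ℕ} (T : PlanePartition (trapezoid N m)) (ν : Fin m → ℕ)
    (h : Appendable T ν) : PlanePartition (trapezoid (N + 1) m) where
  entry i j := if hij : i < m ∧ j = i + N then ν ⟨i, hij.1⟩ else T.entry i j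
  row_weak i j₁ j₂ hj h₁ h₂ := by
    rw [mem_trapezoid] at h₁ h₂
    rcases hj.eq_or_lt with rfl | hlt
    · exact le_rfl
    rw [dif_neg (c := i < m ∧ j₁ = i + N) (by omega)]
    by_cases hj₂ : j₂ = i + N
    · rw [dif_pos ⟨h₁.1, hj₂⟩]
      refine ((h ⟨i, h₁.1⟩).1 (j₂ - 1) (by dsimp only; omega)).trans ?_
      exact T.row_weak i _ _ (by omega) (mem_trapezoid.2 (by omega)) (mem_trapezoid.2 (by omega))
    · rw [dif_neg (by omega)]
      exact T.row_weak i _ _ hj (mem_trapezoid.2 (by omega)) (mem_trapezoid.2 (by omega))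
  col_weak i₁ i₂ j hi h₁ h₂ := by
    rw [mem_trapezoid] at h₁ h₂
    rcases hi.eq_or_lt with rfl | hlt
    · exact le_rfl
    rw [dif_neg (c := i₂ < m ∧ j = i₂ + N) (by omega)]
    by_cases hj : j = i₁ + N
    · subst hj
      rw [dif_pos ⟨h₁.1, rfl⟩]
      refine le_trans ?_ ((h ⟨i₁, h₁.1⟩).2 (by dsimp only; omega))
      exact T.col_weak (i₁ + 1) i₂ (i₁ + N) hlt (mem_trapezoid.2 (by omega))
        (mem_trapezoid.2 (by omega))
    · rw [dif_neg (by omega)]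
      exact T.col_weak _ _ _ hi (mem_trapezoid.2 (by omega)) (mem_trapezoid.2 (by omega))
  zeros i j hij := by
    rw [mem_trapezoid] at hij
    rw [dif_neg (by omega)]
    exact T.zeros _ _ (by rw [mem_trapezoid]; omega)

/-- The plane partition obtained from `T` by removing its rightmost diagonal. -/
def removeDiagonal {N m : ℕ} (T : PlanePartition (trapezoid (N + 1) m)) :
    PlanePartition (trapezoid N m) :=
  T.restrict (trapezoid_subset_trapezoid_succ N m)

theorem removeDiagonal_entry {N m i j : ℕ} (T : PlanePartition (trapezoid (N + 1) m))
    (hi : i < m) (hj : j < i + N) : (removeDiagonal T).entry i j = T.entry i j :=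
  if_pos (mem_trapezoid.2 ⟨hi, hj⟩)

theorem appendable_removeDiagonal {N m : ℕ} (T : PlanePartition (trapezoid (N + 1) m)) :
    Appendable (removeDiagonal T) (trapezoidDiagonal T) := by
  intro r
  have hr := r.2
  refine ⟨fun j hj => ?_, fun hr_succ => ?_⟩
  · rw [removeDiagonal_entry T hr (by omega)]
    exact T.row_weak _ _ _ (by omega) (mem_trapezoid.2 (by omega)) (mem_trapezoid.2 (by omega))
  · rw [removeDiagonal_entry T hr_succ (by omega)]
    exact T.col_weak _ _ _ (by omega) (mem_trapezoid.2 (by omega)) (mem_trapezoid.2 (by omega))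

/-- A plane partition with rightmost diagonal `ν` amounts to a plane partition of the smaller shape
to which `ν` can be appended. -/
def removeDiagonalEquiv {N m : ℕ} (ν : Fin m → ℕ) :
    {T : PlanePartition (trapezoid (N + 1) m) // trapezoidDiagonal T = ν} ≃
      {T : PlanePartition (trapezoid N m) // Appendable T ν} where
  toFun T := ⟨removeDiagonal T.1, by
    have h := appendable_removeDiagonal T.1
    rwa [T.2] at h⟩
  invFun T := ⟨appendDiagonal T.1 ν T.2, funext fun r => dif_pos ⟨r.2, rfl⟩⟩
  left_inv T := by
    obtain ⟨T, rfl⟩ := T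
    refine Subtype.ext (PlanePartition.ext (funext₂ fun i j => ?_))
    simp only [appendDiagonal, removeDiagonal, PlanePartition.restrict, trapezoidDiagonal,
      mem_trapezoid]
    split_ifs with hdiag
    · rw [hdiag.2]
    · rfl
    · exact (T.zeros _ _ (by rw [mem_trapezoid]; omega)).symm
  right_inv T := by
    refine Subtype.ext (PlanePartition.ext (funext₂ fun i j => ?_))
    simp only [appendDiagonal, removeDiagonal, PlanePartition.restrict, mem_trapezoid]
    split_ifs with hmem hdiag
    · omega
    · rfl
    · exact (T.1.zeros _ _ (by rwa [mem_trapezoid])).symm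

theorem volume_eq_sum_trapezoidDiagonal_add {N m : ℕ}
    (T : PlanePartition (trapezoid (N + 1) m)) :
    T.volume = ∑ r, trapezoidDiagonal T r + (removeDiagonal T).volume := by
  have hdiag : ∑ r, trapezoidDiagonal T r = ∑ i ∈ range m, T.entry i (i + N) :=
    (sum_range fun i => T.entry i (i + N)).symm
  rw [volume_trapezoid, volume_trapezoid, hdiag, ← sum_add_distrib]
  refine sum_congr rfl fun i hi => ?_
  rw [← add_assoc, sum_range_succ, add_comm]
  exact congrArg _ (sum_congr rfl fun j hj =>
    (removeDiagonal_entry T (mem_range.1 hi) (mem_range.1 hj)).symm)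

theorem appendable_succ_iff {N m : ℕ} (T : PlanePartition (trapezoid (N + 1) (m + 1)))
    (ν : Fin (m + 1) → ℕ) : Appendable T ν ↔ InterlacesAbove (trapezoidDiagonal T) ν := by
  have hcol (r : ℕ) : r + (N + 1) = r + 1 + N := by omega
  refine ⟨fun h => ⟨(h 0).1 _ rfl, fun j => ⟨(h j.succ).1 _ rfl, ?_⟩⟩, fun h r => ⟨?_, ?_⟩⟩
  · have hbelow := (h j.castSucc).2 (Nat.succ_lt_succ j.2)
    rwa [hcol] at hbelow
  · rintro j hj
    obtain rfl : j = r + N := by omega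
    exact Fin.cases h.1 (fun r => (h.2 r).1) r
  · intro hr
    rw [hcol]
    exact (h.2 ⟨r, Nat.lt_of_succ_lt_succ hr⟩).2

/-- The first row of the trapezoid with `N = 0` is empty and can be removed. -/
def removeEmptyRowEquiv (m : ℕ) :
    PlanePartition (trapezoid 0 (m + 1)) ≃ PlanePartition (trapezoid 1 m) where
  toFun T :=
    { entry := fun i j => T.entry (i + 1) j
      row_weak := fun i j₁ j₂ hj h₁ h₂ => by
        rw [mem_trapezoid] at h₁ h₂
        exact T.row_weak _ _ _ hj (mem_trapezoid.2 (by omega)) (mem_trapezoid.2 (by omega))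
      col_weak := fun i₁ i₂ j hi h₁ h₂ => by
        rw [mem_trapezoid] at h₁ h₂
        exact T.col_weak _ _ _ (by omega) (mem_trapezoid.2 (by omega)) (mem_trapezoid.2 (by omega))
      zeros := fun i j h => T.zeros _ _ (by rw [mem_trapezoid] at h ⊢; omega) }
  invFun T :=
    { entry := fun i j => if i = 0 then 0 else T.entry (i - 1) j
      row_weak := fun i j₁ j₂ hj h₁ h₂ => by
        rw [mem_trapezoid] at h₁ h₂
        rw [if_neg (by omega), if_neg (by omega)]
        exact T.row_weak _ _ _ hj (mem_trapezoid.2 (by omega)) (mem_trapezoid.2 (by omega))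
      col_weak := fun i₁ i₂ j hi h₁ h₂ => by
        rw [mem_trapezoid] at h₁ h₂
        rw [if_neg (by omega), if_neg (by omega)]
        exact T.col_weak _ _ _ (by omega) (mem_trapezoid.2 (by omega)) (mem_trapezoid.2 (by omega))
      zeros := fun i j h => by
        split_ifs with hi
        · rfl
        · exact T.zeros _ _ (by rw [mem_trapezoid] at h ⊢; omega) }
  left_inv T := by
    refine PlanePartition.ext (funext₂ fun i j => ?_)
    dsimp only
    split_ifs with hi
    · exact (T.zeros _ _ (by rw [mem_trapezoid]; omega)).symm
    · rw [Nat.sub_add_cancel (by omega)]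
  right_inv T := PlanePartition.ext (funext₂ fun i j => by simp)

theorem volume_removeEmptyRowEquiv {m : ℕ} (T : PlanePartition (trapezoid 0 (m + 1))) :
    (removeEmptyRowEquiv m T).volume = T.volume := by
  rw [volume_trapezoid, volume_trapezoid, sum_range_succ']
  simp [removeEmptyRowEquiv]

theorem appendable_zero_iff {m : ℕ} (T : PlanePartition (trapezoid 0 (m + 1)))
    (ν : Fin (m + 1) → ℕ) :
    Appendable T ν ↔ InterlacesBelow (trapezoidDiagonal (N := 0) (removeEmptyRowEquiv m T)) ν := by
  refine ⟨fun h j => ⟨(h j.succ).1 _ rfl, (h j.castSucc).2 (Nat.succ_lt_succ j.2)⟩,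
    fun h r => ⟨?_, fun hr => (h ⟨r, Nat.lt_of_succ_lt_succ hr⟩).2⟩⟩
  induction r using Fin.cases with
  | zero => intro j hj; simp at hj
  | succ r =>
    rintro j hj
    obtain rfl : j = r := by simpa using hj
    exact (h r).1

end Diagonals

section DiagonalSums

theorem hasSum_of_sigmaEquiv {α β : Type*} {γ : β → Type*} {f : α → ℝ} (hf : ∀ a, 0 ≤ f a)
    (e : (Σ b, γ b) ≃ α) {g : β → ℝ} (hg : ∀ b, HasSum (fun c => f (e ⟨b, c⟩)) (g b)) {s : ℝ}
    (hs : HasSum g s) : HasSum f s := by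
  rw [← e.hasSum_iff]
  refine HasSum.sigma_of_hasSum hs hg ((summable_sigma_of_nonneg fun _ => hf _).2
    ⟨fun b => (hg b).summable, ?_⟩)
  exact hs.summable.congr fun b => (hg b).tsum_eq.symm

theorem hasSum_of_hasSum_fiber {α β : Type*} {f : α → ℝ} (hf : ∀ a, 0 ≤ f a) {d : α → β}
    {g : β → ℝ} (hg : ∀ b, HasSum (fun a : {a // d a = b} => f a) (g b)) {s : ℝ}
    (hs : HasSum g s) : HasSum f s :=
  hasSum_of_sigmaEquiv hf (Equiv.sigmaFiberEquiv d) hg hs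

theorem hasSum_subtype_of_hasSum_fiber {α β : Type*} {f : α → ℝ} (hf : ∀ a, 0 ≤ f a) {d : α → β}
    {P : β → Prop} {g : β → ℝ} (hg : ∀ b, P b → HasSum (fun a : {a // d a = b} => f a) (g b))
    {s : ℝ} (hs : HasSum (fun b : {b // P b} => g b) s) :
    HasSum (fun a : {a // P (d a)} => f a) s :=
  hasSum_of_sigmaEquiv (f := fun a : {a // P (d a)} => f a)
    (γ := fun b : {b // P b} => {a // d a = b}) (fun a => hf a)
    (Equiv.sigmaSubtypeFiberEquivSubtype d fun _ => Iff.rfl)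
    (fun b => hg b.1 b.2) hs

theorem hasSum_pow_volume_of_equiv {D E : Finset (ℕ × ℕ)} {Q : PlanePartition E → Prop}
    {m m' : ℕ} {d : PlanePartition D → Fin m' → ℕ} {P : (Fin m' → ℕ) → Prop} {ν : Fin m → ℕ}
    (e : {T : PlanePartition E // Q T} ≃ {T : PlanePartition D // P (d T)})
    (he : ∀ T, T.1.volume = ∑ j, ν j + (e T).1.volume)
    {q C c : ℝ} (hq : 0 < q) {y : Fin m' → ℝ} {x : Fin m → ℝ}
    (hC : ∀ ν', P ν' → HasSum (fun T : {T : PlanePartition D // d T = ν'} => q ^ T.1.volume)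
      (C * alternant y ν'))
    (hc : HasSum (fun ν' : {ν' // P ν'} => alternant y ν'.1) (c * alternant x ν)) :
    HasSum (fun T : {T : PlanePartition E // Q T} => q ^ T.1.volume)
      (C * c * (q ^ ∑ j : Fin m, (m - 1 - j.1))⁻¹ * alternant (fun i => q * x i) ν) := by
  have hD : HasSum (fun T : {T : PlanePartition D // P (d T)} => q ^ T.1.volume)
      (C * (c * alternant x ν)) :=
    hasSum_subtype_of_hasSum_fiber (f := fun T : PlanePartition D => q ^ T.volume)
      (g := fun ν' => C * alternant y ν') (fun T => pow_nonneg hq.le T.volume) hC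
      (hc.mul_left C)
  have hval : C * c * (q ^ ∑ j : Fin m, (m - 1 - j.1))⁻¹ * alternant (fun i => q * x i) ν =
      q ^ (∑ j, ν j) * (C * (c * alternant x ν)) := by
    rw [alternant_const_mul]
    field_simp
  simp only [he, pow_add, hval]
  exact (e.hasSum_iff.2 hD).mul_left _

theorem hasSum_pow_volume_trapezoid_succ {N m : ℕ} {q C : ℝ} (hq0 : 0 < q) (hq1 : q < 1)
    (hC : ∀ ν : Fin (m + 1) → ℕ, Antitone ν → HasSum
      (fun T : {T : PlanePartition (trapezoid (N + 1) (m + 1)) // trapezoidDiagonal T = ν} =>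
        q ^ T.1.volume) (C * alternant (fun i => q ^ (N + 1 + i.1)) ν))
    {ν : Fin (m + 1) → ℕ} (hν : Antitone ν) :
    HasSum (fun T : {T : PlanePartition (trapezoid (N + 1 + 1) (m + 1)) //
        trapezoidDiagonal T = ν} => q ^ T.1.volume)
      (C * (∏ i : Fin (m + 1), (1 - q ^ (N + 1 + i.1))⁻¹) *
        (q ^ ∑ j : Fin (m + 1), (m + 1 - 1 - j.1))⁻¹ *
          alternant (fun i => q ^ (N + 1 + 1 + i.1)) ν) := by
  have hx (i : Fin (m + 1)) : ‖q ^ (N + 1 + i.1)‖ < 1 := by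
    rw [norm_pow, Real.norm_of_nonneg hq0.le]
    exact pow_lt_one₀ hq0.le hq1 (by omega)
  have hshift : (fun i : Fin (m + 1) => q ^ (N + 1 + 1 + i.1)) =
      fun i => q * q ^ (N + 1 + i.1) := by
    funext i
    ring
  rw [hshift]
  refine hasSum_pow_volume_of_equiv ((removeDiagonalEquiv ν).trans
    (Equiv.subtypeEquivRight fun T => appendable_succ_iff T ν)) ?_ hq0
    (fun ν' hν' => hC ν' hν'.antitone) (hasSum_alternant_interlacesAbove hx hν)
  rintro ⟨T, rfl⟩
  exact volume_eq_sum_trapezoidDiagonal_add T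

theorem hasSum_pow_volume_trapezoid_one_succ {m : ℕ} {q C : ℝ} (hq0 : 0 < q) (hq1 : q < 1)
    (hC : ∀ ν : Fin m → ℕ, Antitone ν → HasSum
      (fun T : {T : PlanePartition (trapezoid (0 + 1) m) // trapezoidDiagonal T = ν} =>
        q ^ T.1.volume) (C * alternant (fun i => q ^ (0 + 1 + i.1)) ν))
    {ν : Fin (m + 1) → ℕ} (hν : Antitone ν) :
    HasSum (fun T : {T : PlanePartition (trapezoid (0 + 1) (m + 1)) //
        trapezoidDiagonal T = ν} => q ^ T.1.volume)
      (C * (∏ i : Fin m, (1 - q ^ (0 + 1 + i.1))⁻¹) *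
        (q ^ ∑ j : Fin (m + 1), (m + 1 - 1 - j.1))⁻¹ *
          alternant (fun i => q ^ (0 + 1 + i.1)) ν) := by
  have hx (i : Fin m) : q ^ (0 + 1 + i.1) ≠ 1 := (pow_lt_one₀ hq0.le hq1 (by omega)).ne
  have hshift : (fun i : Fin (m + 1) => q ^ (0 + 1 + i.1)) =
      fun i => q * (Fin.cons 1 fun i : Fin m => q ^ (0 + 1 + i.1) : Fin (m + 1) → ℝ) i := by
    funext i
    induction i using Fin.cases with
    | zero => simp
    | succ i => rw [Fin.cons_succ, Fin.val_succ]; ring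
  rw [hshift]
  refine hasSum_pow_volume_of_equiv ((removeDiagonalEquiv ν).trans
    ((removeEmptyRowEquiv m).subtypeEquiv fun T => appendable_zero_iff T ν)) ?_ hq0
    (fun ν' hν' => hC ν' hν'.antitone) (hasSum_alternant_interlacesBelow hx hν)
  rintro ⟨T, rfl⟩
  rw [volume_eq_sum_trapezoidDiagonal_add]
  exact congrArg _ (volume_removeEmptyRowEquiv (removeDiagonal T)).symm

theorem exists_hasSum_pow_volume_trapezoid {q : ℝ} (hq0 : 0 < q) (hq1 : q < 1) (N m : ℕ) :
    ∃ C : ℝ, ∀ ν : Fin m → ℕ, Antitone ν → HasSum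
      (fun T : {T : PlanePartition (trapezoid (N + 1) m) // trapezoidDiagonal T = ν} =>
        q ^ T.1.volume) (C * alternant (fun i => q ^ (N + 1 + i.1)) ν) := by
  induction m generalizing N with
  | zero =>
    refine ⟨1, fun ν _ => ?_⟩
    have hmem (i j) : (i, j) ∉ trapezoid (N + 1) 0 := by simp [mem_trapezoid]
    have : Unique {T : PlanePartition (trapezoid (N + 1) 0) // trapezoidDiagonal T = ν} :=
      { default := ⟨0, funext fun i => i.elim0⟩
        uniq := fun T => Subtype.ext (PlanePartition.ext (funext₂ fun i j =>
          T.1.zeros i j (hmem i j))) }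
    simp [alternant, volume_trapezoid]
  | succ m ihm =>
    induction N with
    | zero =>
      obtain ⟨C, hC⟩ := ihm 0
      exact ⟨_, fun ν hν => hasSum_pow_volume_trapezoid_one_succ hq0 hq1 hC hν⟩
    | succ N ihN =>
      obtain ⟨C, hC⟩ := ihN
      exact ⟨_, fun ν hν => hasSum_pow_volume_trapezoid_succ hq0 hq1 hC hν⟩

end DiagonalSums

section TruncatedRectangle

/-- If every box of `E` to the upper left of a box of `D ⊆ E` lies in `D`, then plane partitions of
shape `D` are those of shape `E` that vanish outside `D`. -/
def PlanePartition.extendEquiv {D E : Finset (ℕ × ℕ)} (hDE : D ⊆ E)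
    (hlower : ∀ a ∈ E, ∀ b ∈ D, a ≤ b → a ∈ D) :
    PlanePartition D ≃ {T : PlanePartition E // ∀ i j, (i, j) ∉ D → T.entry i j = 0} where
  toFun T :=
    ⟨{ entry := T.entry
       row_weak := fun i j₁ j₂ hj h₁ _ => by
         by_cases h₂ : (i, j₂) ∈ D
         · exact T.row_weak i j₁ j₂ hj (hlower _ h₁ _ h₂ ⟨le_rfl, hj⟩) h₂
         · exact (T.zeros _ _ h₂).trans_le (Nat.zero_le _)
       col_weak := fun i₁ i₂ j hi h₁ _ => by
         by_cases h₂ : (i₂, j) ∈ D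
         · exact T.col_weak i₁ i₂ j hi (hlower _ h₁ _ h₂ ⟨hi, le_rfl⟩) h₂
         · exact (T.zeros _ _ h₂).trans_le (Nat.zero_le _)
       zeros := fun i j h => T.zeros i j fun hD => h (hDE hD) }, T.zeros⟩
  invFun T :=
    { entry := T.1.entry
      row_weak := fun i j₁ j₂ hj h₁ h₂ => T.1.row_weak i j₁ j₂ hj (hDE h₁) (hDE h₂)
      col_weak := fun i₁ i₂ j hi h₁ h₂ => T.1.col_weak i₁ i₂ j hi (hDE h₁) (hDE h₂)
      zeros := T.2 }
  left_inv _ := rfl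
  right_inv _ := rfl

theorem PlanePartition.volume_extendEquiv {D E : Finset (ℕ × ℕ)} (hDE : D ⊆ E)
    (hlower : ∀ a ∈ E, ∀ b ∈ D, a ≤ b → a ∈ D) (T : PlanePartition D) :
    (extendEquiv hDE hlower T).1.volume = T.volume :=
  (sum_subset hDE fun b _ hb => T.zeros b.1 b.2 hb).symm

theorem entry_eq_zero_of_trapezoidDiagonal_eq_zero {N m : ℕ}
    (T : PlanePartition (trapezoid (N + 1) m)) {r : Fin m} (hr : trapezoidDiagonal T r = 0)
    (i : ℕ) : T.entry i (r + N) = 0 := by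
  by_cases h : (i, r + N) ∈ trapezoid (N + 1) m
  · rw [mem_trapezoid] at h
    refine Nat.le_zero.1 (le_of_le_of_eq ?_ hr)
    exact T.col_weak r i (r + N) (by omega) (mem_trapezoid.2 (by omega))
      (mem_trapezoid.2 (by omega))
  · exact T.zeros _ _ h

theorem mem_truncatedRectangle {n m k i j : ℕ} :
    (i, j) ∈ truncatedRectangle n m k ↔ i < m ∧ j < n ∧ j < n - (k - i) := by
  simp only [truncatedRectangle, mem_filter, mem_product, mem_range, and_assoc]

theorem truncatedRectangle_subset_trapezoid (n m k : ℕ) :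
    truncatedRectangle n m k ⊆ trapezoid (n - k - 1 + 1) m := by
  rintro ⟨i, j⟩ h
  rw [mem_truncatedRectangle] at h
  rw [mem_trapezoid]
  omega

theorem mem_truncatedRectangle_of_le {n m k : ℕ} (hkn : k < n) :
    ∀ a ∈ trapezoid (n - k - 1 + 1) m, ∀ b ∈ truncatedRectangle n m k, a ≤ b →
      a ∈ truncatedRectangle n m k := by
  rintro ⟨i, j⟩ ha ⟨i', j'⟩ hb ⟨hi, hj⟩
  rw [mem_trapezoid] at ha
  rw [mem_truncatedRectangle] at hb ⊢
  dsimp only at hi hj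
  omega

theorem PlanePartition.hasRightmostDiagonal_iff_eq {n m k : ℕ} (hkn : k < n) (hkm : k < m)
    {μ : ℕ → ℕ} (hμ0 : ∀ i, k < i → μ i = 0) (T : PlanePartition (truncatedRectangle n m k)) :
    T.HasRightmostDiagonal μ ↔
      (fun r : Fin m => T.entry r (r + (n - k - 1))) = fun r : Fin m => μ r := by
  refine ⟨fun h => funext fun r => ?_, fun h r hr => ?_⟩
  · rcases le_or_gt r.1 k with hr | hr
    · rw [add_comm]
      exact h r hr
    · rw [hμ0 r hr]
      exact T.zeros _ _ (by rw [mem_truncatedRectangle]; omega)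
  · rw [add_comm]
    exact congrFun h ⟨r, hr.trans_lt hkm⟩

theorem entry_eq_zero_of_notMem_truncatedRectangle {n m k : ℕ} (hkn : k < n) {μ : ℕ → ℕ}
    (hμ0 : ∀ i, k < i → μ i = 0) {T : PlanePartition (trapezoid (n - k - 1 + 1) m)}
    (hT : trapezoidDiagonal T = fun r : Fin m => μ r) (i j : ℕ)
    (hij : (i, j) ∉ truncatedRectangle n m k) : T.entry i j = 0 := by
  by_cases hmem : (i, j) ∈ trapezoid (n - k - 1 + 1) m
  · rw [mem_trapezoid] at hmem
    rw [mem_truncatedRectangle] at hij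
    obtain ⟨r, rfl⟩ : ∃ r, j = r + (n - k - 1) := ⟨j - (n - k - 1), by omega⟩
    exact entry_eq_zero_of_trapezoidDiagonal_eq_zero T (r := ⟨r, by omega⟩)
      ((congrFun hT _).trans (hμ0 r (by omega))) i
  · exact T.zeros _ _ hmem

/-- Plane partitions of shape `n^m ∖ δ_k` with rightmost diagonal `μ` are the same as plane
partitions of trapezoidal shape whose rightmost diagonal is `μ` padded with zeros. -/
def truncatedRectangleEquiv {n m k : ℕ} (hkn : k < n) (hkm : k < m) {μ : ℕ → ℕ}
    (hμ0 : ∀ i, k < i → μ i = 0) :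
    {T : PlanePartition (truncatedRectangle n m k) // T.HasRightmostDiagonal μ} ≃
      {T : PlanePartition (trapezoid (n - k - 1 + 1) m) //
        trapezoidDiagonal T = fun r : Fin m => μ r} :=
  ((PlanePartition.extendEquiv (truncatedRectangle_subset_trapezoid n m k)
    (mem_truncatedRectangle_of_le hkn)).subtypeEquiv
      fun T => T.hasRightmostDiagonal_iff_eq hkn hkm hμ0).trans
    (Equiv.subtypeSubtypeEquivSubtype (entry_eq_zero_of_notMem_truncatedRectangle hkn hμ0))

theorem volume_truncatedRectangleEquiv {n m k : ℕ} (hkn : k < n) (hkm : k < m) {μ : ℕ → ℕ}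
    (hμ0 : ∀ i, k < i → μ i = 0)
    (T : {T : PlanePartition (truncatedRectangle n m k) // T.HasRightmostDiagonal μ}) :
    (truncatedRectangleEquiv hkn hkm hμ0 T).1.volume = T.1.volume :=
  PlanePartition.volume_extendEquiv (truncatedRectangle_subset_trapezoid n m k)
    (mem_truncatedRectangle_of_le hkn) T.1

theorem exists_hasSum_pow_volume_truncatedRectangle {n m k : ℕ} (hkn : k < n) (hkm : k < m)
    {q : ℝ} (hq0 : 0 < q) (hq1 : q < 1) :
    ∃ C : ℝ, ∀ μ : BoundedPartition (k + 1),
      HasSum (fun T : {T : PlanePartition (truncatedRectangle n m k) //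
        T.HasRightmostDiagonal μ.1} => q ^ T.1.volume)
        (C * alternant (fun i : Fin m => q ^ (n - k + i.1)) fun j => μ.1 j) := by
  obtain ⟨C, hC⟩ := exists_hasSum_pow_volume_trapezoid hq0 hq1 (n - k - 1) m
  refine ⟨C, fun μ => ?_⟩
  have hx : (fun i : Fin m => q ^ (n - k + i.1)) = fun i => q ^ (n - k - 1 + 1 + i.1) := by
    rw [Nat.sub_add_cancel (Nat.sub_pos_of_lt hkn)]
  rw [hx]
  have h := (truncatedRectangleEquiv hkn hkm μ.2.2).hasSum_iff.2
    (hC (fun j => μ.1 j) fun i j hij => μ.2.1 hij)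
  exact h.congr_fun fun T => congrArg (q ^ ·) (volume_truncatedRectangleEquiv hkn hkm μ.2.2 T).symm

/-- The rightmost diagonal of a plane partition of shape `n^m ∖ δ_k`, padded with zeros. -/
def PlanePartition.rightmostDiagonal {n m k : ℕ} (hkn : k < n) (hkm : k < m)
    (T : PlanePartition (truncatedRectangle n m k)) : BoundedPartition (k + 1) :=
  ⟨fun r => if r ≤ k then T.entry r (n - k - 1 + r) else 0, by
    refine antitone_nat_of_succ_le fun r => ?_
    split_ifs with h₁ h₂
    · refine (T.row_weak (r + 1) (n - k - 1 + r) (n - k - 1 + (r + 1)) (by omega)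
        (mem_truncatedRectangle.2 (by omega)) (mem_truncatedRectangle.2 (by omega))).trans ?_
      exact T.col_weak _ _ _ (by omega)
        (mem_truncatedRectangle.2 (by omega)) (mem_truncatedRectangle.2 (by omega))
    · omega
    · exact Nat.zero_le _
    · exact le_rfl, fun i hi => if_neg (by omega)⟩

theorem PlanePartition.rightmostDiagonal_eq_iff {n m k : ℕ} (hkn : k < n) (hkm : k < m)
    (T : PlanePartition (truncatedRectangle n m k)) (μ : BoundedPartition (k + 1)) :
    T.rightmostDiagonal hkn hkm = μ ↔ T.HasRightmostDiagonal μ.1 := by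
  constructor
  · rintro rfl r hr
    exact (if_pos hr).symm
  · refine fun h => Subtype.ext (funext fun r => ?_)
    simp only [rightmostDiagonal]
    split_ifs with hr
    · exact h r hr
    · exact (μ.2.2 r (by omega)).symm

theorem kingMatrixOf_pow_eq_kingMatrix (n m k : ℕ) (q : ℝ) :
    kingMatrixOf (k + 1) (fun i : Fin m => q ^ (n - k + i.1)) = kingMatrix n m k q := by
  ext i j
  simp only [kingMatrixOf, kingMatrix, of_apply, ← pow_mul, Nat.succ_le_iff, Nat.sub_sub]

theorem hasSum_pow_volume_truncatedRectangle {n m k : ℕ} (hkn : k < n) (hkm : k < m)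
    {q C : ℝ} (hq0 : 0 < q) (hq1 : q < 1)
    (hC : ∀ μ : BoundedPartition (k + 1),
      HasSum (fun T : {T : PlanePartition (truncatedRectangle n m k) //
        T.HasRightmostDiagonal μ.1} => q ^ T.1.volume)
        (C * alternant (fun i : Fin m => q ^ (n - k + i.1)) fun j => μ.1 j)) :
    HasSum (fun T : PlanePartition (truncatedRectangle n m k) => q ^ T.volume)
      (C * ((kingMatrix n m k q).det / littlewoodProd fun i : Fin m => q ^ (n - k + i.1))) := by
  have hx (i : Fin m) : ‖q ^ (n - k + i.1)‖ < 1 := by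
    rw [norm_pow, Real.norm_of_nonneg hq0.le]
    exact pow_lt_one₀ hq0.le hq1 (by omega)
  rw [← kingMatrixOf_pow_eq_kingMatrix]
  have hfiber (μ : BoundedPartition (k + 1)) :
      HasSum (fun T : {T : PlanePartition (truncatedRectangle n m k) //
        T.rightmostDiagonal hkn hkm = μ} => q ^ T.1.volume)
        (C * alternant (fun i : Fin m => q ^ (n - k + i.1)) fun j => μ.1 j) := by
    have h := hC μ
    rw [← (Equiv.subtypeEquivRight fun T : PlanePartition (truncatedRectangle n m k) =>
      T.rightmostDiagonal_eq_iff hkn hkm μ).hasSum_iff] at h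
    exact h
  exact hasSum_of_hasSum_fiber
    (f := fun T : PlanePartition (truncatedRectangle n m k) => q ^ T.volume)
    (fun T => pow_nonneg hq0.le T.volume) hfiber
    ((hasSum_alternant_boundedPartition hkm hx).mul_left C)

theorem tsum_pow_volume_pos {D : Finset (ℕ × ℕ)} {q : ℝ} (hq : 0 < q)
    (h : Summable fun T : PlanePartition D => q ^ T.volume) :
    0 < ∑' T : PlanePartition D, q ^ T.volume :=
  h.tsum_pos (fun T => pow_nonneg hq.le T.volume) 0 (pow_pos hq _)

end TruncatedRectangle

section Numerator

theorem prod_range_prod_range_eq_prod_prod_Iio {R : Type*} [CommMonoid R] (m : ℕ)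
    (f : ℕ → ℕ → R) :
    ∏ j ∈ range m, ∏ i ∈ range j, f i j = ∏ j : Fin m, ∏ i ∈ Iio j, f i j := by
  rw [prod_range]
  refine prod_congr rfl fun j _ => ?_
  rw [← Nat.Iio_eq_range, ← Fin.map_valEmbedding_Iio, prod_map]
  rfl

theorem prod_prod_Iio_const {R : Type*} [CommMonoid R] (m : ℕ) (a : R) :
    ∏ j : Fin m, ∏ _i ∈ Iio j, a = ∏ j : Fin m, a ^ (m - 1 - j.1) := by
  simp only [prod_const, Fin.card_Iio]
  rw [← Equiv.prod_comp Fin.revPerm]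
  refine prod_congr rfl fun j _ => ?_
  rw [Fin.revPerm_apply, Fin.val_rev, Nat.sub_sub, add_comm 1]

theorem alternant_pow_mul_littlewoodProd {R : Type*} [CommRing R] {m : ℕ} (q : R) (N : ℕ)
    (ν : Fin m → ℕ) :
    alternant (fun i => q ^ (N + i.1)) ν * littlewoodProd (fun i : Fin m => q ^ (N + i.1)) =
      q ^ ((∑ j, ν j) * N) * (∏ i : Fin m, (1 - q ^ (N + i.1))) *
        ∏ j : Fin m, ∏ i ∈ Iio j,
          q ^ N * (q ^ (ν j + (m - 1 - j.1)) - q ^ (ν i + (m - 1 - i.1))) *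
            (1 - q ^ (2 * N + i.1 + j.1)) := by
  have hpow : ∏ j : Fin m, q ^ (N * (ν j + (m - 1 - j.1))) =
      q ^ ((∑ j, ν j) * N) * ∏ j : Fin m, ∏ _i ∈ Iio j, q ^ N := by
    simp only [prod_prod_Iio_const, mul_add, pow_add, prod_mul_distrib, ← pow_mul]
    rw [prod_pow_eq_pow_sum, ← mul_sum, mul_comm N]
  have hpair (i j : Fin m) : q ^ (N + i.1) * q ^ (N + j.1) = q ^ (2 * N + i.1 + j.1) := by
    ring
  rw [alternant_pow, littlewoodProd, hpow]
  simp only [hpair, prod_mul_distrib]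
  ring

end Numerator

theorem mainTheorem12 (n m k : ℕ) (hkn : k < n) (hkm : k < m) (q : ℝ) (hq0 : 0 < q) (hq1 : q < 1)
    (μ : ℕ → ℕ) (hμ : Antitone μ) (hμ0 : ∀ i, k < i → μ i = 0) :
    Summable (fun T : PlanePartition (truncatedRectangle n m k) => q ^ T.volume) ∧
    (kingMatrix n m k q).det ≠ 0 ∧
    diagonalDistribution n m k q μ =
      (q ^ ((∑ i ∈ Finset.range (k + 1), μ i) * (n - k)) *
        (∏ i ∈ Finset.range m, (1 - q ^ (n - k + i))) *
        ∏ j ∈ Finset.range m, ∏ i ∈ Finset.range j,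
          q ^ (n - k) * (q ^ (μ j + (m - 1 - j)) - q ^ (μ i + (m - 1 - i))) *
            (1 - q ^ (2 * (n - k) + i + j))) /
      (kingMatrix n m k q).det := by
  obtain ⟨C, hC⟩ := exists_hasSum_pow_volume_truncatedRectangle hkn hkm hq0 hq1
  have htotal := hasSum_pow_volume_truncatedRectangle hkn hkm hq0 hq1 hC
  have hpos := tsum_pow_volume_pos hq0 htotal.summable
  rw [htotal.tsum_eq] at hpos
  have hC0 : C ≠ 0 := left_ne_zero_of_mul hpos.ne'
  have hdet0 : (kingMatrix n m k q).det ≠ 0 :=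
    fun h => hpos.ne' (by rw [h, zero_div, mul_zero])
  have hsum : ∑ i ∈ range (k + 1), μ i = ∑ i : Fin m, μ i := by
    rw [← sum_range]
    exact sum_subset (range_subset_range.2 hkm) fun i _ hi => hμ0 i (by simpa using hi)
  refine ⟨htotal.summable, hdet0, ?_⟩
  rw [diagonalDistribution, htotal.tsum_eq, (hC ⟨μ, hμ, hμ0⟩).tsum_eq, hsum, prod_range,
    prod_range_prod_range_eq_prod_prod_Iio, ← alternant_pow_mul_littlewoodProd,
    mul_div_mul_left _ _ hC0, div_div_eq_mul_div]
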